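/- Let $n\ge 1$ be an integer and $\lambda>0$, and let $$\phi\in\Big(0,\tfrac12\arccos\tfrac{2\lambda-n-1}{2\lambda+n+1}\Big)\cup\Big(\pi-\tfrac12\arccos\tfrac{2\lambda-n-1}{2\lambda+n+1},\ \pi\Big).$$ For $m\ge 0$ and $\mu>0$ let $$P_m^{(\mu)}(x;\phi)=i^m(2\mu)_m\Big(\frac{e^{2i\phi}}{e^{2i\phi}-1}\Big)^m{}_2F_1\big(-m,\mu+ix;2\mu;1-e^{-2i\phi}\big)$$ be the monic Meixner–Pollaczek polynomial, and put $P:=P_n^{(\lambda)}(\cdot;\phi)$ and $G:=P_{n+1}^{(\lambda+1)}(\cdot;\phi)$. Let $$T_{n,\lambda,\phi}(x)=(1-\cos 2\phi)x^2+(n+1)\sin(2\phi)\,x+\lambda^2-(\lambda^2+n\lambda+\lambda)\cos 2\phi .$$ For polynomials $p,q$ with only real simple zeros $u_1<u_2<\cdots$ and $v_1<v_2<\cdots$ respectively, write $p\prec q$ if either $\deg p=\deg q+1=m+1$ and $u_1<v_1<u_2<\cdots<v_m<u_{m+1}$, or $\deg p=\deg q=m$ and $u_1<v_1<u_2<\cdots<u_m<v_m$.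 Assume that $P$ and $G$ have no common zero. Then $T_{n,\lambda,\phi}$ has exactly two real zeros $E_1<E_2$, namely $$E_{1,2}=\frac{-(n+1)\sin 2\phi\mp\sqrt{(n+1+2\lambda)^2(1-\cos2\phi)\big(\cos 2\phi-\frac{2\lambda-n-1}{2\lambda+n+1}\big)}}{2(1-\cos 2\phi)},$$ all zeros $z_1<\dots<z_n$ of $P$ and $y_1<\dots<y_{n+1}$ of $G$ are real and simple, and the following hold. 1. It is impossible that both $E_1<y_1$ and $E_2>y_{n+1}$. 2. If $E_1$ and $E_2$ both lie in $(-\infty,y_1)$, or both lie in $(y_k,y_{k+1})$ for some $k\in\{1,\dots,n\}$, or both lie in $(y_{n+1},\infty)$, then $G\prec P$. 3. If $E_1<y_1$ and $y_k<E_2<y_{k+1}$ for some $k\in\{1,\dots,n\}$, then $(x-E_2)P\prec G$. 4. If $E_2>y_{n+1}$ and $y_k<E_1<y_{k+1}$ for some $k\in\{1,\dots,n\}$, then $G\prec(x-E_1)P$. 5. Suppose $k\ne k'$ in $\{1,\dots,n\}$ satisfy $y_k<E_1<y_{k+1}$ and $y_{k'}<E_2<y_{k'+1}$, and let $l\in\{1,\dots,n-1\}$.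 (i) If $y_k<z_l<E_1<z_{l+1}<y_{k+1}$, then $(x-E_1)G\prec(x-E_2)P$. (ii) If $y_{k'}<z_l<E_2<z_{l+1}<y_{k'+1}$, then $(x-E_2)G\prec(x-E_1)P$. -/

import Mathlib

open Polynomial

noncomputable section

namespace MP

/-- The terminating series `₂F₁(-n, lam + i x; 2 lam; 1 - 1 / e^{2 i φ})`, as a polynomial in `x`. -/
def hypPoly (n : ℕ) (lam φ : ℝ) : ℂ[X] :=
  ∑ k ∈ Finset.range (n + 1),
    C (((ascPochhammer ℂ k).eval (-(n : ℂ))) / ((ascPochhammer ℂ k).eval (2 * (lam : ℂ)))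
        * (1 - 1 / Complex.exp (2 * Complex.I * φ)) ^ k / (k.factorial : ℂ))
      * (ascPochhammer ℂ k).comp (C (lam : ℂ) + C Complex.I * X)

/-- The monic Meixner–Pollaczek polynomial `P_n^{(lam)}(x; φ)`,
`i^n (2 lam)_n (e^{2iφ} / (e^{2iφ} - 1))^n ₂F₁(-n, lam + i x; 2 lam; 1 - 1 / e^{2iφ})`. -/
def meixnerPollaczek (n : ℕ) (lam φ : ℝ) : ℂ[X] :=
  C (Complex.I ^ n * (ascPochhammer ℂ n).eval (2 * (lam : ℂ))
      * (Complex.exp (2 * Complex.I * φ) / (Complex.exp (2 * Complex.I * φ) - 1)) ^ n)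
    * hypPoly n lam φ

/-- The values of `meixnerPollaczek`, in terms of Mathlib's Gauss hypergeometric function. -/
theorem meixnerPollaczek_eval (n : ℕ) (lam φ : ℝ) (x : ℂ) :
    (meixnerPollaczek n lam φ).eval x =
      Complex.I ^ n * (ascPochhammer ℂ n).eval (2 * (lam : ℂ))
        * (Complex.exp (2 * Complex.I * φ) / (Complex.exp (2 * Complex.I * φ) - 1)) ^ n
        * ordinaryHypergeometric (-(n : ℂ)) ((lam : ℂ) + Complex.I * x) (2 * (lam : ℂ))
            (1 - 1 / Complex.exp (2 * Complex.I * φ)) := by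
  rw [meixnerPollaczek, eval_mul, eval_C, ordinaryHypergeometric_eq_tsum, hypPoly, eval_finsetSum]
  congr 1
  dsimp only
  rw [tsum_eq_sum (s := Finset.range (n + 1))]
  · refine Finset.sum_congr rfl fun k _ => ?_
    simp only [eval_mul, eval_C, eval_comp, eval_add, eval_X, smul_eq_mul]
    ring
  · intro k hk
    have hk' : n < k := by simpa [Nat.lt_succ_iff] using hk
    have h0 : (ascPochhammer ℂ k).eval (-(n : ℂ)) = 0 :=
      (ascPochhammer_eval_eq_zero_iff k _).2 ⟨n, hk', by simp⟩
    simp [h0]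

/-- The quadratic `T_{n, lam, φ}(x)`. -/
def quadT (n : ℕ) (lam φ x : ℝ) : ℝ :=
  (1 - Real.cos (2 * φ)) * x ^ 2 + ((n : ℝ) + 1) * Real.sin (2 * φ) * x
    + (lam ^ 2 - (lam ^ 2 + n * lam + lam) * Real.cos (2 * φ))

/-- The discriminant of `T_{n, lam, φ}`, in factored form. -/
def disc (n : ℕ) (lam φ : ℝ) : ℝ :=
  ((n : ℝ) + 1 + 2 * lam) ^ 2 * (1 - Real.cos (2 * φ))
    * (Real.cos (2 * φ) - (2 * lam - n - 1) / (2 * lam + n + 1))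

/-- The smaller zero of `T_{n, lam, φ}`. -/
def E₁ (n : ℕ) (lam φ : ℝ) : ℝ :=
  (-((n : ℝ) + 1) * Real.sin (2 * φ) - Real.sqrt (disc n lam φ)) / (2 * (1 - Real.cos (2 * φ)))

/-- The larger zero of `T_{n, lam, φ}`. -/
def E₂ (n : ℕ) (lam φ : ℝ) : ℝ :=
  (-((n : ℝ) + 1) * Real.sin (2 * φ) + Real.sqrt (disc n lam φ)) / (2 * (1 - Real.cos (2 * φ)))

/-- The set of admissible `φ`. -/
def phiRange (n : ℕ) (lam : ℝ) : Set ℝ :=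
  Set.Ioo 0 (1 / 2 * Real.arccos ((2 * lam - n - 1) / (2 * lam + n + 1))) ∪
    Set.Ioo (Real.pi - 1 / 2 * Real.arccos ((2 * lam - n - 1) / (2 * lam + n + 1))) Real.pi

/-- `u 0 < u 1 < ⋯ < u (m - 1)` are all the complex zeros of `p`; in particular `p` has degree `m`
and its zeros are real and simple (`roots` counts multiplicity). -/
def IsZeros {m : ℕ} (p : ℂ[X]) (u : Fin m → ℝ) : Prop :=
  p ≠ 0 ∧ StrictMono u ∧ p.roots = Finset.univ.val.map (fun k => ((u k : ℝ) : ℂ))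

/-- `p ≺ q` for `deg p = deg q + 1`: the zeros of `p` and `q` satisfy
`u₁ < v₁ < u₂ < v₂ < ⋯ < v_m < u_{m+1}`. -/
def Interlace (p q : ℂ[X]) : Prop :=
  ∃ (m : ℕ) (u : Fin (m + 1) → ℝ) (v : Fin m → ℝ), IsZeros p u ∧ IsZeros q v ∧
    ∀ k : Fin m, u k.castSucc < v k ∧ v k < u k.succ

/-- `p ≺ q` for `deg p = deg q`: the zeros of `p` and `q` satisfy
`u₁ < v₁ < u₂ < v₂ < ⋯ < u_m < v_m`. -/
def Alternate (p q : ℂ[X]) : Prop :=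
  ∃ (m : ℕ) (u v : Fin m → ℝ), IsZeros p u ∧ IsZeros q v ∧
    (∀ k : Fin m, u k < v k) ∧ ∀ k l : Fin m, l.val = k.val + 1 → v k < u l

/-- The linear polynomial `x - E`. -/
def lin (E : ℝ) : ℂ[X] := X - C (E : ℂ)

end MP

end

namespace MP

/-! Everything rests on one identity. At a zero `y` of `G`, contiguous relations give `P(y)` as a
positive constant times `T(y) Q(y)`, where `Q` is the polynomial of degree `n` with the same
parameter `lam + 1` as `G` (`mp_eval_of_root`). `Q` precedes `G` in one orthogonal sequence, so it
alternates in sign along the zeros of `G` (`mp_eval_root_sign`). Since `T` is a positive multiple of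
`(x - E₁)(x - E₂)`, the sign of `P` at each zero of `G` depends only on where that zero lies
relative to `E₁` and `E₂`.

Multiplying `P` by a suitable linear factor turns one factor of `T` into a square and restores
alternation. The intermediate value theorem then puts a zero in each gap, and the degree leaves room
for no others. Where a zero outside the gaps is needed, it comes from comparing an end value with
the sign at infinity.

The recurrence defining `mp` is tied to the hypergeometric definition by `map_mp`;
Christoffel–Darboux arguments give real simple zeros. -/

/-- The real monic Meixner–Pollaczek polynomials, by their three-term recurrence. -/
noncomputable def mp (lam φ : ℝ) : ℕ → ℝ[X]
  | 0 => 1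
  | 1 => X + C (lam * (Real.cos φ / Real.sin φ))
  | n + 2 => (X + C ((n + 1 + lam) * (Real.cos φ / Real.sin φ))) * mp lam φ (n + 1)
      - C ((n + 1) * (n + 2 * lam) / (4 * Real.sin φ ^ 2)) * mp lam φ n

theorem mp_succ_succ (lam φ : ℝ) (n : ℕ) : mp lam φ (n + 2) =
    (X + C ((n + 1 + lam) * (Real.cos φ / Real.sin φ))) * mp lam φ (n + 1)
      - C ((n + 1) * (n + 2 * lam) / (4 * Real.sin φ ^ 2)) * mp lam φ n := by
  rw [mp]

/-! ### Gauss series and the three-term recurrence -/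

/-- The terminating Gauss series `₂F₁(-n, b; c; t)` with binomial coefficients. -/
noncomputable def gaussSum (n : ℕ) (b c t : ℂ) : ℂ :=
  ∑ k ∈ Finset.range (n + 1), (-1) ^ k * (n.choose k : ℂ) * t ^ k / (ascPochhammer ℂ k).eval c
    * (ascPochhammer ℂ k).eval b

theorem gaussSum_eq_of_le {n N : ℕ} (h : n + 1 ≤ N) (b c t : ℂ) :
    gaussSum n b c t = ∑ k ∈ Finset.range N, (-1) ^ k * (n.choose k : ℂ) * t ^ k
      / (ascPochhammer ℂ k).eval c * (ascPochhammer ℂ k).eval b := by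
  unfold gaussSum
  refine Finset.sum_subset (Finset.range_mono h) fun k _ hk => ?_
  have : n < k := by simpa [Nat.lt_succ_iff] using hk
  simp [Nat.choose_eq_zero_of_lt this]

theorem ascPochhammer_eval_ne_zero {c : ℂ} (hc : ∀ k : ℕ, c + k ≠ 0) (k : ℕ) :
    (ascPochhammer ℂ k).eval c ≠ 0 := by
  induction k with
  | zero => simp
  | succ k ih => rw [ascPochhammer_succ_eval]; exact mul_ne_zero ih (hc k)

theorem gaussSum_zero (b c t : ℂ) : gaussSum 0 b c t = 1 := by simp [gaussSum]

theorem gaussSum_one (b c t : ℂ) : gaussSum 1 b c t = 1 - t * b / c := by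
  simp [gaussSum, Finset.sum_range_succ]; ring

/-- The contiguous relation of Gauss in the terminating parameter. -/
theorem gaussSum_contiguous {c : ℂ} (hc : ∀ k : ℕ, c + k ≠ 0) (n : ℕ) (b t : ℂ) :
    (c + (n + 1)) * gaussSum (n + 2) b c t =
      (2 * (n + 1) + c - (b + (n + 1)) * t) * gaussSum (n + 1) b c t
        + (n + 1) * (t - 1) * gaussSum n b c t := by
  have hp := ascPochhammer_eval_ne_zero hc
  -- Telescoping certificate: `b (b)_k = (b)_{k+1} - k (b)_k`, so the `b`-term of the relation
  -- contributes `f`, and the rest cancels up to the shift `g` of `f`.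
  set f : ℕ → ℂ := fun k => (-1) ^ k * ((n + 1).choose k : ℂ) * t ^ (k + 1)
      / (ascPochhammer ℂ k).eval c * (ascPochhammer ℂ (k + 1)).eval b with hf
  set g : ℕ → ℂ := fun k => match k with | 0 => 0 | k + 1 => f k with hg
  -- The boundary terms vanish: `f (n + 2)` contains `(n + 1).choose (n + 2)`, and `g 0 = 0`.
  have hfg : ∑ k ∈ Finset.range (n + 3), f k = ∑ k ∈ Finset.range (n + 3), g k := by
    rw [Finset.sum_range_succ, Finset.sum_range_succ' g]
    simp [hf, hg]
  rw [gaussSum_eq_of_le (N := n + 3) (by omega), gaussSum_eq_of_le (N := n + 3) (by omega),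
    gaussSum_eq_of_le (N := n + 3) (by omega) (n := n), ← sub_eq_zero]
  have key : ∀ k ∈ Finset.range (n + 3),
      (c + (n + 1)) * ((-1) ^ k * ((n + 2).choose k : ℂ) * t ^ k
        / (ascPochhammer ℂ k).eval c * (ascPochhammer ℂ k).eval b)
      - (2 * (n + 1) + c - (b + (n + 1)) * t) * ((-1) ^ k * ((n + 1).choose k : ℂ) * t ^ k
        / (ascPochhammer ℂ k).eval c * (ascPochhammer ℂ k).eval b)
      - (n + 1) * (t - 1) * ((-1) ^ k * (n.choose k : ℂ) * t ^ k
        / (ascPochhammer ℂ k).eval c * (ascPochhammer ℂ k).eval b) = f k - g k := by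
    intro k _
    rcases k with _ | k
    · simp [hf, hg]; ring
    · have h1 : ((n + 2).choose (k + 1) : ℂ) = (n + 1).choose k + (n + 1).choose (k + 1) := by
        rw [Nat.choose_succ_succ]; push_cast; ring
      have h2 : ((n + 1).choose (k + 1) : ℂ) = n.choose k + n.choose (k + 1) := by
        rw [Nat.choose_succ_succ]; push_cast; ring
      have h3 : ((n : ℂ) + 1) * n.choose k = (n + 1).choose (k + 1) * (k + 1) := by
        have := Nat.add_one_mul_choose_eq n k
        exact_mod_cast this
      simp only [hf, hg]
      rw [ascPochhammer_succ_eval (S := ℂ) (k + 1), h1]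
      have e := hp (k + 1)
      have e' := hp k
      have hck := hc k
      have hs := ascPochhammer_succ_eval (S := ℂ) k c
      rw [show (-1 : ℂ) ^ k * ((n + 1).choose k : ℂ) * t ^ (k + 1) / (ascPochhammer ℂ k).eval c
        = (c + k) * ((-1 : ℂ) ^ k * ((n + 1).choose k : ℂ) * t ^ (k + 1))
          / (ascPochhammer ℂ (k + 1)).eval c by rw [hs]; field_simp]
      have h4 : (n.choose k : ℂ) = (n + 1).choose (k + 1) - n.choose (k + 1) := by
        rw [h2]; ring
      rw [h4] at h3
      have h5 : ((n : ℂ) + 1 - k) * (n + 1).choose k = (k + 1) * (n + 1).choose (k + 1) := by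
        have := Nat.choose_succ_right_eq (n + 1) k
        rcases le_or_gt k (n + 1) with h | h
        · have h' : (((n + 1 - k : ℕ)) : ℂ) = n + 1 - k := by push_cast [Nat.cast_sub h]; ring
          rw [← h', mul_comm, mul_comm ((k : ℂ) + 1)]
          exact_mod_cast this.symm
        · simp [Nat.choose_eq_zero_of_lt h, Nat.choose_eq_zero_of_lt (Nat.lt_succ_of_lt h)]
      field_simp
      push_cast
      linear_combination (-(-1) ^ k * t ^ (k + 1) * (ascPochhammer ℂ (k + 1)).eval b) *
        (h5 - (1 - t) * h3)
  have := Finset.sum_congr rfl key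
  rw [Finset.sum_sub_distrib (s := Finset.range (n + 3)) f g, hfg, sub_self] at this
  rw [← this, Finset.sum_sub_distrib, Finset.sum_sub_distrib, ← Finset.mul_sum, ← Finset.mul_sum,
    ← Finset.mul_sum]
  ring

theorem exp_two_I_mul (φ : ℝ) : Complex.exp (2 * Complex.I * φ) =
    ((Real.cos φ : ℂ) + Complex.I * Real.sin φ) ^ 2 := by
  rw [show 2 * Complex.I * (φ : ℂ) = φ * Complex.I + φ * Complex.I by ring, Complex.exp_add,
    Complex.exp_mul_I]
  push_cast
  ring

theorem sin_sq_add_cos_sq_cast (φ : ℝ) :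
    (Real.sin φ : ℂ) ^ 2 + (Real.cos φ : ℂ) ^ 2 = 1 := by
  exact_mod_cast Real.sin_sq_add_cos_sq φ

theorem one_div_exp_two_I_mul (φ : ℝ) : 1 / Complex.exp (2 * Complex.I * φ) =
    ((Real.cos φ : ℂ) - Complex.I * Real.sin φ) ^ 2 := by
  rw [div_eq_iff (Complex.exp_ne_zero _), exp_two_I_mul, ← mul_pow]
  have h : ((Real.cos φ : ℂ) - Complex.I * Real.sin φ) * (Real.cos φ + Complex.I * Real.sin φ)
      = 1 := by
    linear_combination sin_sq_add_cos_sq_cast φ - (Real.sin φ : ℂ) ^ 2 * Complex.I_sq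
  rw [h, one_pow]

theorem one_sub_one_div_exp (φ : ℝ) : 1 - 1 / Complex.exp (2 * Complex.I * φ) =
    2 * Complex.I * Real.sin φ * (Real.cos φ - Complex.I * Real.sin φ) := by
  rw [one_div_exp_two_I_mul]
  linear_combination -sin_sq_add_cos_sq_cast φ + (Real.sin φ : ℂ) ^ 2 * Complex.I_sq

theorem exp_div_exp_sub_one {φ : ℝ} (hs : Real.sin φ ≠ 0) :
    Complex.I * (Complex.exp (2 * Complex.I * φ) / (Complex.exp (2 * Complex.I * φ) - 1)) =
      (Real.cos φ + Complex.I * Real.sin φ) / (2 * Real.sin φ) := by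
  have hs' : (Real.sin φ : ℂ) ≠ 0 := by exact_mod_cast hs
  have he : Complex.exp (2 * Complex.I * φ) - 1 =
      2 * Complex.I * Real.sin φ * (Real.cos φ + Complex.I * Real.sin φ) := by
    rw [exp_two_I_mul]
    linear_combination sin_sq_add_cos_sq_cast φ - (Real.sin φ : ℂ) ^ 2 * Complex.I_sq
  have h0 : (Real.cos φ : ℂ) + Complex.I * Real.sin φ ≠ 0 := by
    intro h
    have := exp_two_I_mul φ
    rw [h] at this
    exact Complex.exp_ne_zero _ (this.trans (by simp))
  rw [he, exp_two_I_mul]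
  have := Complex.I_ne_zero
  field_simp

theorem hypPoly_eval (n : ℕ) (lam φ : ℝ) (x : ℂ) : (hypPoly n lam φ).eval x =
    gaussSum n (lam + Complex.I * x) (2 * lam) (1 - 1 / Complex.exp (2 * Complex.I * φ)) := by
  rw [hypPoly, gaussSum, eval_finsetSum]
  refine Finset.sum_congr rfl fun k _ => ?_
  simp only [eval_mul, eval_C, eval_comp, eval_add, eval_X]
  rw [ascPochhammer_eval_neg_eq_descPochhammer, ← Nat.cast_id n]
  have h : (descPochhammer ℂ k).eval (n : ℂ) = (k.factorial : ℂ) * (n.choose k : ℂ) := by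
    rw [descPochhammer_eval_eq_descFactorial, Nat.descFactorial_eq_factorial_mul_choose]
    push_cast; rfl
  have hk : (k.factorial : ℂ) ≠ 0 := by exact_mod_cast k.factorial_ne_zero
  rw [Nat.cast_id, h]
  field_simp

theorem meixnerPollaczek_eval_eq {φ : ℝ} (hs : Real.sin φ ≠ 0) (n : ℕ) (lam : ℝ) (x : ℂ) :
    (meixnerPollaczek n lam φ).eval x = (ascPochhammer ℂ n).eval (2 * (lam : ℂ))
      * ((Real.cos φ + Complex.I * Real.sin φ) / (2 * Real.sin φ)) ^ n
      * gaussSum n (lam + Complex.I * x) (2 * lam)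
        (2 * Complex.I * Real.sin φ * (Real.cos φ - Complex.I * Real.sin φ)) := by
  rw [meixnerPollaczek, eval_mul, eval_C, hypPoly_eval, ← exp_div_exp_sub_one hs,
    one_sub_one_div_exp, mul_pow]
  ring

theorem two_mul_add_ne_zero {lam : ℝ} (hlam : 0 < lam) (k : ℕ) : 2 * (lam : ℂ) + k ≠ 0 := by
  have : 2 * lam + k ≠ 0 := by positivity
  exact_mod_cast this

/-- Gauss's contiguous relation, rescaled by the monic normalisation, is exactly the recurrence of
`mp`. -/
theorem eval_map_mp {φ : ℝ} (hs : Real.sin φ ≠ 0) {lam : ℝ} (hlam : 0 < lam) (x : ℂ) :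
    ∀ n : ℕ, (meixnerPollaczek n lam φ).eval x = ((mp lam φ n).map Complex.ofRealHom).eval x := by
  have hc := two_mul_add_ne_zero hlam
  have hs' : (Real.sin φ : ℂ) ≠ 0 := by exact_mod_cast hs
  have hl : (lam : ℂ) ≠ 0 := by exact_mod_cast hlam.ne'
  have hsq := sin_sq_add_cos_sq_cast φ
  intro n
  induction n using Nat.twoStepInduction with
  | zero => rw [meixnerPollaczek_eval_eq hs]; simp [gaussSum_zero, mp]
  | one =>
    rw [meixnerPollaczek_eval_eq hs, gaussSum_one]
    simp only [mp, ascPochhammer_one, eval_X, pow_one, Polynomial.map_add, map_X, map_C,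
      eval_add, eval_C, Complex.ofRealHom_eq_coe]
    push_cast at *
    generalize Complex.sin φ = s at *
    generalize Complex.cos φ = c at *
    field_simp
    linear_combination (-Complex.I * s * (lam + x * Complex.I)) * hsq +
      (Complex.I * (lam + x * Complex.I) * s ^ 3 - s * x) * Complex.I_sq
  | more n ih1 ih2 =>
    rw [mp_succ_succ, Polynomial.map_sub, Polynomial.map_mul, Polynomial.map_mul, eval_sub,
      eval_mul, eval_mul, ← ih2, ← ih1, meixnerPollaczek_eval_eq hs, meixnerPollaczek_eval_eq hs,
      meixnerPollaczek_eval_eq hs]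
    have h := gaussSum_contiguous hc n (lam + Complex.I * x)
      (2 * Complex.I * Real.sin φ * (Real.cos φ - Complex.I * Real.sin φ))
    generalize gaussSum (n + 2) _ _ _ = F2 at *
    generalize gaussSum (n + 1) _ _ _ = F1 at *
    generalize gaussSum n _ _ _ = F0 at *
    simp only [Polynomial.map_add, map_X, map_C, eval_add, eval_X, eval_C,
      Complex.ofRealHom_eq_coe]
    rw [ascPochhammer_succ_eval (S := ℂ) (n + 1), ascPochhammer_succ_eval (S := ℂ) n]
    push_cast at *
    generalize Complex.sin φ = s at *
    generalize Complex.cos φ = c at *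
    generalize eval (2 * (lam : ℂ)) (ascPochhammer ℂ n) = A
    -- `q` is the normalising factor per degree. With `t` the argument of the series, the recurrence
    -- coefficients come from `q t = i`, `2 q = cot φ + i` and `q² (t - 1) = -1 / (4 sin² φ)`.
    set q := (c + Complex.I * s) / (2 * s) with hq
    have hq1 : q * (2 * Complex.I * s * (c - Complex.I * s)) = Complex.I := by
      rw [hq]; field_simp
      linear_combination hsq - s ^ 2 * Complex.I_sq
    have hq2 : 2 * q = c / s + Complex.I := by rw [hq]; field_simp
    have hq3 : q ^ 2 * (2 * Complex.I * s * (c - Complex.I * s) - 1) = - (1 / (4 * s ^ 2)) := by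
      have hz : 2 * Complex.I * s * (c - Complex.I * s) - 1 = -(c - Complex.I * s) ^ 2 := by
        linear_combination hsq - s ^ 2 * Complex.I_sq
      have hcs : (c + Complex.I * s) * (c - Complex.I * s) = 1 := by
        linear_combination hsq - s ^ 2 * Complex.I_sq
      rw [hz, hq, show ((c + Complex.I * s) / (2 * s)) ^ 2 * -(c - Complex.I * s) ^ 2
        = -(((c + Complex.I * s) * (c - Complex.I * s)) ^ 2 / (4 * s ^ 2)) by ring, hcs, one_pow]
    have e1 : q * (2 * (n + 1) + 2 * lam - (lam + Complex.I * x + (n + 1))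
        * (2 * Complex.I * s * (c - Complex.I * s))) = x + (n + 1 + lam) * (c / s) := by
      linear_combination (n + 1 + lam) * hq2 - (lam + Complex.I * x + (n + 1)) * hq1
        - x * Complex.I_sq
    rw [← e1, show ((n : ℂ) + 1) * (n + 2 * lam) / (4 * s ^ 2)
      = -((n + 1) * (n + 2 * lam)) * (-(1 / (4 * s ^ 2))) by ring, ← hq3]
    linear_combination (A * (2 * lam + n) * q ^ (n + 2)) * h

theorem map_mp {φ : ℝ} (hs : Real.sin φ ≠ 0) {lam : ℝ} (hlam : 0 < lam) (n : ℕ) :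
    meixnerPollaczek n lam φ = (mp lam φ n).map Complex.ofRealHom :=
  Polynomial.funext fun x => eval_map_mp hs hlam x n

/-! ### Relations between the parameters `lam` and `lam + 1` -/

theorem mp_zero_eval (lam φ x : ℝ) : (mp lam φ 0).eval x = 1 := by simp [mp]

theorem mp_one_eval (lam φ x : ℝ) :
    (mp lam φ 1).eval x = x + lam * (Real.cos φ / Real.sin φ) := by simp [mp]

/-- Makes the recurrence polynomial in `cot φ`, so that later identities are ring identities. -/
theorem one_div_four_sin_sq {φ : ℝ} (hs : Real.sin φ ≠ 0) :
    1 / (4 * Real.sin φ ^ 2) = (1 + (Real.cos φ / Real.sin φ) ^ 2) / 4 := by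
  have hsq := Real.sin_sq_add_cos_sq φ
  field_simp
  linear_combination -hsq

theorem mp_succ_succ_eval {φ : ℝ} (hs : Real.sin φ ≠ 0) (lam x : ℝ) (n : ℕ) :
    (mp lam φ (n + 2)).eval x =
      (x + (n + 1 + lam) * (Real.cos φ / Real.sin φ)) * (mp lam φ (n + 1)).eval x
      - (n + 1) * (n + 2 * lam) * ((1 + (Real.cos φ / Real.sin φ) ^ 2) / 4)
        * (mp lam φ n).eval x := by
  rw [mp_succ_succ, ← one_div_four_sin_sq hs]
  simp only [eval_sub, eval_mul, eval_add, eval_X, eval_C]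
  ring

/-- Expansion of the polynomials with parameter `lam` in those with parameter `lam + 1`. -/
theorem mp_lower {φ : ℝ} (hs : Real.sin φ ≠ 0) (lam x : ℝ) (n : ℕ) :
    (mp lam φ (n + 2)).eval x = (mp (lam + 1) φ (n + 2)).eval x
      - (n + 2) * (Real.cos φ / Real.sin φ) * (mp (lam + 1) φ (n + 1)).eval x
      + (n + 2) * (n + 1) * ((1 + (Real.cos φ / Real.sin φ) ^ 2) / 4)
        * (mp (lam + 1) φ n).eval x := by
  have r := mp_succ_succ_eval hs lam x
  have g := mp_succ_succ_eval hs (lam + 1) x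
  -- The coefficients reflect the factor `1 - 2 t cos φ + t²` relating the two generating functions;
  -- the recurrences suffice to verify them.
  induction n using Nat.twoStepInduction with
  | zero =>
    rw [r, g]
    simp only [mp_zero_eval, mp_one_eval, zero_add]
    push_cast; ring
  | one =>
    rw [r, r, g, g]
    simp only [mp_zero_eval, mp_one_eval, zero_add]
    push_cast; ring
  | more n ih1 ih2 =>
    rw [r (n + 2), ih1, ih2]
    have g0 := g n
    have g1 := g (n + 1)
    have g2 := g (n + 2)
    push_cast at *
    generalize Real.cos φ / Real.sin φ = κ at *
    linear_combination -g2 + (n + 3) * κ * g1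
      - (n + 3) * (n + 2) * ((1 + κ ^ 2) / 4) * g0

/-- The recurrence for `lam + 1` eliminates the lowest of the three terms in `mp_lower`. -/
theorem mp_lower_two_term {φ : ℝ} (hs : Real.sin φ ≠ 0) {lam : ℝ} (x : ℝ) (n : ℕ) :
    (n + 1 + 2 * lam) * (mp lam φ (n + 1)).eval x = 2 * lam * (mp (lam + 1) φ (n + 1)).eval x
      + (n + 1) * (x - lam * (Real.cos φ / Real.sin φ)) * (mp (lam + 1) φ n).eval x := by
  cases n with
  | zero =>
    simp only [mp_zero_eval, mp_one_eval, zero_add]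
    push_cast; ring
  | succ n =>
    have g := mp_succ_succ_eval hs (lam + 1) x n
    rw [mp_lower hs]
    push_cast
    linear_combination (n + 2) * g

/-- At a zero of `mp (lam + 1) φ (n + 1)`, the polynomials `mp lam φ n` and `mp (lam + 1) φ n` are
proportional, up to the quadratic `quadT`. -/
theorem mp_eval_of_root {φ : ℝ} (hs : Real.sin φ ≠ 0) {lam : ℝ} {n : ℕ} (hn : 1 ≤ n) {y : ℝ}
    (hy : (mp (lam + 1) φ (n + 1)).eval y = 0) :
    (n + 2 * lam) * (n + 1 + 2 * lam) * (mp lam φ n).eval y =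
      2 * quadT n lam φ y * (mp (lam + 1) φ n).eval y := by
  obtain ⟨n, rfl⟩ : ∃ m, n = m + 1 := ⟨n - 1, by omega⟩
  have h := mp_lower_two_term hs (lam := lam) y n
  rw [mp_succ_succ_eval hs, ← one_div_four_sin_sq hs] at hy
  have hsq := Real.cos_sq' φ
  rw [quadT, Real.cos_two_mul, Real.sin_two_mul, hsq]
  push_cast at *
  generalize eval y (mp (lam + 1) φ (n + 1)) = G1 at *
  generalize eval y (mp (lam + 1) φ n) = G0 at *
  generalize eval y (mp lam φ (n + 1)) = P at *
  generalize Real.cos φ = c at *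
  generalize Real.sin φ = s at *
  field_simp at hy h
  -- `hy` expresses the value of index `n` through `G1`. Substituting it in `h` multiplies two
  -- linear factors in `y`, which is where the quadratic arises.
  have : s ^ 2 * ((n + 1 + 2 * lam) * (n + 1 + 1 + 2 * lam) * P) = s ^ 2 * (2 *
      ((1 - (2 * (1 - s ^ 2) - 1)) * y ^ 2 + (n + 1 + 1) * (2 * s * c) * y
        + (lam ^ 2 - (lam ^ 2 + (n + 1) * lam + lam) * (2 * (1 - s ^ 2) - 1))) * G1) := by
    linear_combination s * (n + 1 + 1 + 2 * lam) * h - s * (y * s - lam * c) * hy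
      - 4 * s ^ 2 * lam * (n + 2 + lam) * G1 * hsq
  exact mul_left_cancel₀ (pow_ne_zero 2 hs) this

/-! ### Real and simple zeros -/

theorem mp_monic (lam φ : ℝ) (n : ℕ) :
    (mp lam φ n).Monic ∧ (mp lam φ n).natDegree = n := by
  induction n using Nat.twoStepInduction with
  | zero => simp [mp]
  | one => exact ⟨monic_X_add_C _, natDegree_X_add_C _⟩
  | more n ih1 ih2 =>
    rw [mp_succ_succ]
    set a := (n + 1 + lam) * (Real.cos φ / Real.sin φ)
    set b := (n + 1) * (n + 2 * lam) / (4 * Real.sin φ ^ 2)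
    have hm : ((X + C a) * mp lam φ (n + 1)).Monic := (monic_X_add_C a).mul ih2.1
    have hd : ((X + C a) * mp lam φ (n + 1)).natDegree = n + 2 := by
      rw [(monic_X_add_C a).natDegree_mul ih2.1, natDegree_X_add_C, ih2.2]; omega
    have hlt : (C b * mp lam φ n).natDegree < ((X + C a) * mp lam φ (n + 1)).natDegree := by
      rw [hd]
      exact (natDegree_C_mul_le b _).trans_lt (by rw [ih1.2]; omega)
    exact ⟨hm.sub_of_left (degree_lt_degree hlt),
      (natDegree_sub_eq_left_of_natDegree_lt hlt).trans hd⟩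

/-- Positivity of the confluent Christoffel–Darboux kernel. -/
theorem mp_wronskian_pos {lam φ : ℝ} (hlam : 0 < lam) (hs : Real.sin φ ≠ 0) (x : ℝ) (n : ℕ) :
    0 < (mp lam φ (n + 1)).derivative.eval x * (mp lam φ n).eval x
      - (mp lam φ (n + 1)).eval x * (mp lam φ n).derivative.eval x := by
  induction n with
  | zero => simp [mp]
  | succ n ih =>
    have hb : 0 < (n + 1) * (n + 2 * lam) / (4 * Real.sin φ ^ 2) := by positivity
    have h2 : 0 ≤ (mp lam φ (n + 1)).eval x ^ 2 := sq_nonneg _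
    rw [mp_succ_succ]
    simp only [derivative_sub, derivative_mul, derivative_add, derivative_X, derivative_C,
      eval_sub, eval_add, eval_mul, eval_X, eval_C, eval_one, eval_zero]
    -- With `W_n` the Wronskian, `W_{n+1} = p_{n+1}² + b W_n`.
    nlinarith [mul_pos hb ih]

/-- The Christoffel–Darboux argument for the absence of zeros in the upper half plane. -/
theorem mp_im_pos {lam φ : ℝ} (hlam : 0 < lam) (hs : Real.sin φ ≠ 0) {x : ℂ} (hx : 0 < x.im)
    (n : ℕ) : 0 < (((mp lam φ (n + 1)).map Complex.ofRealHom).eval x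
      * (starRingEnd ℂ) (((mp lam φ n).map Complex.ofRealHom).eval x)).im := by
  induction n with
  | zero =>
    have e : ((mp lam φ 1).map Complex.ofRealHom).eval x =
        x + ((lam * (Real.cos φ / Real.sin φ) : ℝ) : ℂ) := by simp [mp]
    have e0 : ((mp lam φ 0).map Complex.ofRealHom).eval x = 1 := by simp [mp]
    rw [zero_add, e, e0, map_one, mul_one, Complex.add_im, Complex.ofReal_im, add_zero]
    exact hx
  | succ n ih =>
    have hb : 0 < (n + 1) * (n + 2 * lam) / (4 * Real.sin φ ^ 2) := by positivity
    have h0 : ((mp lam φ (n + 1)).map Complex.ofRealHom).eval x ≠ 0 := by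
      intro h; rw [h] at ih; simp at ih
    have hn := mul_pos hx (Complex.normSq_pos.2 h0)
    rw [mp_succ_succ]
    simp only [Polynomial.map_sub, Polynomial.map_add, Polynomial.map_mul, map_X, map_C, eval_sub,
      eval_add, eval_mul, eval_X, eval_C, Complex.ofRealHom_eq_coe]
    generalize ((n : ℝ) + 1 + lam) * (Real.cos φ / Real.sin φ) = a
    generalize ((n : ℝ) + 1) * (n + 2 * lam) / (4 * Real.sin φ ^ 2) = b at *
    simp only [Complex.normSq_apply, Complex.mul_im, Complex.mul_re, Complex.sub_re, Complex.sub_im,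
      Complex.add_re, Complex.add_im, Complex.conj_re, Complex.conj_im, Complex.ofReal_re,
      Complex.ofReal_im] at *
    -- The new imaginary part is `Im x · |p_{n+1}(x)|²` plus `b` times the previous one; the real
    -- `a` drops out.
    nlinarith [mul_pos hb ih]

theorem mp_ne_zero_of_im_pos {lam φ : ℝ} (hlam : 0 < lam) (hs : Real.sin φ ≠ 0) {x : ℂ}
    (hx : 0 < x.im) (n : ℕ) : ((mp lam φ n).map Complex.ofRealHom).eval x ≠ 0 := by
  cases n with
  | zero => simp [mp]
  | succ n => intro h; have := mp_im_pos hlam hs hx n; rw [h] at this; simp at this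

/-- Real coefficients make the zeros symmetric under conjugation, so excluding the upper half plane
is enough. -/
theorem im_eq_zero_of_isRoot {lam φ : ℝ} (hlam : 0 < lam) (hs : Real.sin φ ≠ 0) {x : ℂ} {n : ℕ}
    (h : ((mp lam φ n).map Complex.ofRealHom).eval x = 0) : x.im = 0 := by
  rcases lt_trichotomy x.im 0 with hx | hx | hx
  · refine absurd ?_ (mp_ne_zero_of_im_pos hlam hs (x := (starRingEnd ℂ) x) (by simpa using hx) n)
    have e := Polynomial.hom_eval₂ (mp lam φ n) Complex.ofRealHom (starRingEnd ℂ) x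
    have hc : (starRingEnd ℂ).comp Complex.ofRealHom = Complex.ofRealHom := by
      ext r; simp
    rw [← eval_map, h, map_zero, hc] at e
    rw [eval_map, ← e]
  · exact hx
  · exact absurd h (mp_ne_zero_of_im_pos hlam hs hx n)

section Roots

variable {q : ℝ[X]} {m : ℕ}

theorem roots_eq_of_injective (hq : q.Monic) (hd : q.natDegree = m) {u : Fin m → ℝ}
    (hu : Function.Injective u) (h0 : ∀ k, q.eval (u k) = 0) :
    q.roots = Finset.univ.val.map u := by
  symm
  refine Multiset.eq_of_le_of_card_le ?_ ?_
  · refine (Multiset.le_iff_subset (Finset.univ.nodup.map hu)).2 fun x hx => ?_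
    obtain ⟨k, -, rfl⟩ := Multiset.mem_map.1 hx
    exact (mem_roots hq.ne_zero).2 (h0 k)
  · simpa [hd] using q.card_roots'

theorem eval_eq_prod (hq : q.Monic) (hd : q.natDegree = m) {u : Fin m → ℝ}
    (hu : Function.Injective u) (h0 : ∀ k, q.eval (u k) = 0) :
    q = ∏ k, (X - C (u k)) := by
  have hr := roots_eq_of_injective hq hd hu h0
  have := prod_multiset_X_sub_C_of_monic_of_roots_card_eq hq (by rw [hr]; simp [hd])
  rw [← this, hr, Multiset.map_map]
  rfl

/-- As many distinct real zeros as the degree are all the complex zeros, each simple. -/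
theorem isZeros_map (hq : q.Monic) (hd : q.natDegree = m) {u : Fin m → ℝ} (hu : StrictMono u)
    (h0 : ∀ k, q.eval (u k) = 0) : IsZeros (q.map Complex.ofRealHom) u := by
  refine ⟨(hq.map _).ne_zero, hu, ?_⟩
  have hp := eval_eq_prod hq hd hu.injective h0
  have hr : q.map Complex.ofRealHom = (Finset.univ.val.map fun k => X - C ((u k : ℂ))).prod := by
    conv_lhs => rw [hp]
    rw [Polynomial.map_prod]
    simp [Finset.prod]
  rw [hr, ← roots_multiset_prod_X_sub_C (Finset.univ.val.map fun k => ((u k : ℝ) : ℂ)),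
    Multiset.map_map]
  rfl

theorem IsZeros.eval_eq_zero {u : Fin m → ℝ} (h : IsZeros (q.map Complex.ofRealHom) u) (k : Fin m) :
    q.eval (u k) = 0 := by
  have hk : ((u k : ℝ) : ℂ) ∈ (q.map Complex.ofRealHom).roots := by
    rw [h.2.2]; exact Multiset.mem_map_of_mem _ (Finset.mem_univ_val k)
  have := (mem_roots h.1).1 hk
  rw [IsRoot, eval_map] at this
  have e : Polynomial.eval₂ Complex.ofRealHom ((u k : ℝ) : ℂ) q = ((q.eval (u k) : ℝ) : ℂ) :=
    (Polynomial.hom_eval₂ q (RingHom.id ℝ) Complex.ofRealHom (u k)).symm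
  rw [e] at this
  exact_mod_cast this

end Roots

/-- Complex zeros are real, so the polynomial splits over `ℝ`; a double zero would annihilate the
positive Wronskian. -/
theorem exists_isZeros_mp {lam φ : ℝ} (hlam : 0 < lam) (hs : Real.sin φ ≠ 0) (n : ℕ) :
    ∃ u : Fin n → ℝ, IsZeros ((mp lam φ n).map Complex.ofRealHom) u := by
  obtain ⟨hm, hd⟩ := mp_monic lam φ n
  set p := mp lam φ n with hp
  have hsplit : p.Splits := by
    refine (IsAlgClosed.splits (p.map Complex.ofRealHom)).of_splits_map Complex.ofRealHom
      fun a ha => ⟨a.re, ?_⟩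
    have := im_eq_zero_of_isRoot hlam hs (mem_roots'.1 ha).2
    exact Complex.ext (by simp) (by simp [this])
  have hnodup : p.roots.Nodup := by
    refine Multiset.nodup_iff_count_le_one.2 fun x => ?_
    rw [count_roots]
    by_contra! hx
    obtain ⟨h0, h1⟩ := (one_lt_rootMultiplicity_iff_isRoot hm.ne_zero).1 hx
    have hW := mp_wronskian_pos hlam hs x
    cases n with
    | zero => simp [hp, mp] at h0
    | succ n =>
      have := hW n
      rw [← hp, h0.eq_zero, h1.eq_zero] at this
      simp at this
  have hcard : p.roots.toFinset.card = n := by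
    rw [Multiset.toFinset_card_of_nodup hnodup, ← hd]
    exact hsplit.natDegree_eq_card_roots.symm
  refine ⟨p.roots.toFinset.orderEmbOfFin hcard, isZeros_map hm hd (OrderEmbedding.strictMono _) ?_⟩
  intro k
  have := p.roots.toFinset.orderEmbOfFin_mem hcard k
  rw [Multiset.mem_toFinset] at this
  exact (mem_roots'.1 this).2

/-- The sign of the preceding polynomial of the sequence at the zeros of `mp lam φ (n + 1)`. -/
theorem mp_eval_root_sign {lam φ : ℝ} (hlam : 0 < lam) (hs : Real.sin φ ≠ 0) {n : ℕ}
    {y : Fin (n + 1) → ℝ} (hy : StrictMono y) (h0 : ∀ k, (mp lam φ (n + 1)).eval (y k) = 0)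
    (k : Fin (n + 1)) : 0 < (-1) ^ (n - k.val) * (mp lam φ n).eval (y k) := by
  have hW := mp_wronskian_pos hlam hs (y k) n
  rw [h0 k, zero_mul, sub_zero] at hW
  obtain ⟨hm, hd⟩ := mp_monic lam φ (n + 1)
  have hp := eval_eq_prod hm hd hy.injective h0
  have hder : (mp lam φ (n + 1)).derivative.eval (y k) = ∏ j ∈ Finset.univ.erase k, (y k - y j) := by
    rw [hp, derivative_prod_finset, eval_finsetSum, Finset.sum_eq_single k]
    · simp [eval_prod]
    · intro j _ hj
      rw [eval_mul, eval_prod, Finset.prod_eq_zero (Finset.mem_erase.2 ⟨hj.symm, Finset.mem_univ k⟩)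
        (by simp), zero_mul]
    · simp
  have hsplit : Finset.univ.erase k = Finset.Iio k ∪ Finset.Ioi k := by
    ext j; simp [lt_or_lt_iff_ne]
  have hdisj : Disjoint (Finset.Iio k) (Finset.Ioi k) := by
    rw [Finset.disjoint_left]; intro j h1 h2
    exact lt_asymm (Finset.mem_Iio.1 h1) (Finset.mem_Ioi.1 h2)
  -- Exactly `n - k` zeros lie to the right of `y k`, each contributing a sign to the derivative
  -- there.
  have hR : ∏ j ∈ Finset.Ioi k, (y k - y j) =
      (-1) ^ (n - k.val) * ∏ j ∈ Finset.Ioi k, (y j - y k) := by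
    have hc : (Finset.Ioi k).card = n - k.val := by rw [Fin.card_Ioi]; omega
    rw [← hc, ← Finset.prod_const, ← Finset.prod_mul_distrib]
    exact Finset.prod_congr rfl fun j _ => by ring
  rw [hder, hsplit, Finset.prod_union hdisj, hR] at hW
  have hA : 0 < ∏ j ∈ Finset.Iio k, (y k - y j) :=
    Finset.prod_pos fun j hj => sub_pos.2 (hy (Finset.mem_Iio.1 hj))
  have hB : 0 < ∏ j ∈ Finset.Ioi k, (y j - y k) :=
    Finset.prod_pos fun j hj => sub_pos.2 (hy (Finset.mem_Ioi.1 hj))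
  refine pos_of_mul_pos_right ?_ (mul_pos hA hB).le
  linarith

/-! ### Interlacing from zeros in gaps -/

section Interlacing

variable {p q : ℝ[X]} {m : ℕ}

theorem exists_root_of_mul_neg (q : ℝ[X]) {a b : ℝ} (hab : a < b) (h : q.eval a * q.eval b < 0) :
    ∃ x, a < x ∧ x < b ∧ q.eval x = 0 := by
  have hc : ContinuousOn (fun x => q.eval x) (Set.Icc a b) := q.continuous.continuousOn
  rcases mul_neg_iff.1 h with ⟨h1, h2⟩ | ⟨h1, h2⟩
  · obtain ⟨x, hx, hx0⟩ := intermediate_value_Ioo' hab.le hc ⟨h2, h1⟩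
    exact ⟨x, hx.1, hx.2, hx0⟩
  · obtain ⟨x, hx, hx0⟩ := intermediate_value_Ioo hab.le hc ⟨h1, h2⟩
    exact ⟨x, hx.1, hx.2, hx0⟩

theorem strictMono_of_gaps {w : Fin (m + 1) → ℝ} {v : Fin m → ℝ}
    (h : ∀ k : Fin m, w k.castSucc < v k ∧ v k < w k.succ) : StrictMono w ∧ StrictMono v := by
  have hw : StrictMono w := Fin.strictMono_iff_lt_succ.2 fun k => (h k).1.trans (h k).2
  refine ⟨hw, fun i j hij => (h i).2.trans_le ((hw.monotone ?_).trans (h j).1.le)⟩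
  exact Fin.succ_le_castSucc_iff.2 hij

/-- One zero per gap already accounts for the whole degree of `q`, so any choice lists all its zeros
in order. -/
theorem interlace_of_gaps (hp : p.Monic) (hpd : p.natDegree = m + 1) (hq : q.Monic)
    (hqd : q.natDegree = m) {w : Fin (m + 1) → ℝ} (hw : ∀ k, p.eval (w k) = 0)
    (h : ∀ k : Fin m, ∃ x, w k.castSucc < x ∧ x < w k.succ ∧ q.eval x = 0) :
    Interlace (p.map Complex.ofRealHom) (q.map Complex.ofRealHom) := by
  choose v h1 h2 h3 using h
  obtain ⟨hwm, hvm⟩ := strictMono_of_gaps fun k => ⟨h1 k, h2 k⟩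
  exact ⟨m, w, v, isZeros_map hp hpd hwm hw, isZeros_map hq hqd hvm h3, fun k => ⟨h1 k, h2 k⟩⟩

/-- For `k = 0` the lower bound is vacuous: the first zero only has to lie left of `v 0`. -/
theorem alternate_of_left (hp : p.Monic) (hpd : p.natDegree = m) (hq : q.Monic)
    (hqd : q.natDegree = m) {v : Fin m → ℝ} (hvm : StrictMono v) (hv : ∀ k, q.eval (v k) = 0)
    (h : ∀ k : Fin m, ∃ x, p.eval x = 0 ∧ x < v k ∧ ∀ l : Fin m, k.val = l.val + 1 → v l < x) :
    Alternate (p.map Complex.ofRealHom) (q.map Complex.ofRealHom) := by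
  choose u h1 h2 h3 using h
  have hum : StrictMono u := by
    intro i j hij
    have hij' : i.val < j.val := hij
    refine (h2 i).trans_le ((hvm.monotone ?_).trans (h3 j ⟨j.val - 1, by omega⟩ ?_).le)
    · exact Fin.le_def.2 (by simp only; omega)
    · simp only; omega
  exact ⟨m, u, v, isZeros_map hp hpd hum h1, isZeros_map hq hqd hvm hv, h2,
    fun k l hkl => h3 l k hkl⟩

theorem alternate_of_right (hp : p.Monic) (hpd : p.natDegree = m) (hq : q.Monic)
    (hqd : q.natDegree = m) {u : Fin m → ℝ} (hum : StrictMono u) (hu : ∀ k, p.eval (u k) = 0)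
    (h : ∀ k : Fin m, ∃ x, q.eval x = 0 ∧ u k < x ∧ ∀ l : Fin m, l.val = k.val + 1 → x < u l) :
    Alternate (p.map Complex.ofRealHom) (q.map Complex.ofRealHom) := by
  choose v h1 h2 h3 using h
  have hvm : StrictMono v := by
    intro i j hij
    have hij' : i.val < j.val := hij
    refine (h3 i ⟨i.val + 1, by omega⟩ rfl).trans_le ((hum.monotone ?_).trans (h2 j).le)
    exact Fin.le_def.2 (by simp only; omega)
  exact ⟨m, u, v, isZeros_map hp hpd hum hu, isZeros_map hq hqd hvm h1, h2,
    fun k l hkl => h3 k l hkl⟩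

/-- A monic real-rooted polynomial is nonnegative from its largest zero onwards. -/
theorem exists_root_gt (hq : q.Monic) (hqd : q.natDegree = m) {z : Fin m → ℝ} (hz : StrictMono z)
    (h0 : ∀ k, q.eval (z k) = 0) {x : ℝ} (hx : q.eval x < 0) : ∃ k, x < z k := by
  by_contra! h
  rw [eval_eq_prod hq hqd hz.injective h0, eval_prod] at hx
  exact hx.not_ge (Finset.prod_nonneg fun k _ => by simpa using h k)

theorem exists_root_lt (hq : q.Monic) (hqd : q.natDegree = m) {z : Fin m → ℝ} (hz : StrictMono z)
    (h0 : ∀ k, q.eval (z k) = 0) {x : ℝ} (hx : (-1) ^ m * q.eval x < 0) : ∃ k, z k < x := by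
  by_contra! h
  have hm : (-1 : ℝ) ^ m = ∏ _k : Fin m, (-1 : ℝ) := by simp
  rw [eval_eq_prod hq hqd hz.injective h0, eval_prod, hm, ← Finset.prod_mul_distrib] at hx
  exact hx.not_ge (Finset.prod_nonneg fun k _ => by simpa using h k)

/-- Values with alternating signs at the nodes `y` force a zero in each gap. -/
theorem exists_root_gap {n : ℕ} {y : Fin (n + 1) → ℝ} (hy : StrictMono y) {s : Fin (n + 1) → ℝ}
    (hs : ∀ k : Fin (n + 1), q.eval (y k) = (-1) ^ (n - k.val) * s k) (i : Fin n)
    (h : 0 < s i.castSucc * s i.succ) :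
    ∃ x, y i.castSucc < x ∧ x < y i.succ ∧ q.eval x = 0 := by
  refine exists_root_of_mul_neg q (hy Fin.castSucc_lt_succ) ?_
  rw [hs, hs, Fin.val_castSucc, Fin.val_succ]
  have e : n - i.val = n - (i.val + 1) + 1 := by omega
  have e2 : ((-1 : ℝ) ^ (n - (i.val + 1))) * (-1) ^ (n - (i.val + 1)) = 1 := by
    rw [← mul_pow]; simp
  rw [e, pow_succ]
  linear_combination h - s i.castSucc * s i.succ * e2

end Interlacing

/-! ### The quadratic and its zeros -/

theorem phiRange_facts {n : ℕ} {lam φ : ℝ} (hlam : 0 < lam) (hφ : φ ∈ phiRange n lam) :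
    0 < Real.sin φ ∧ (2 * lam - n - 1) / (2 * lam + n + 1) < Real.cos (2 * φ) := by
  have hn : (0 : ℝ) ≤ n := n.cast_nonneg
  have hD : 0 < 2 * lam + n + 1 := by positivity
  set r := (2 * lam - n - 1) / (2 * lam + n + 1) with hr
  have h1 : -1 ≤ r := by rw [hr, le_div_iff₀ hD]; linarith
  have h2 : r ≤ 1 := by rw [hr, div_le_iff₀ hD]; linarith
  have hpi := Real.arccos_le_pi r
  have key : ∀ t : ℝ, 0 ≤ t → t < Real.arccos r → r < Real.cos t := by
    intro t ht0 ht
    rw [← Real.cos_arccos h1 h2]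
    exact Real.cos_lt_cos_of_nonneg_of_le_pi ht0 hpi ht
  have hpp := Real.pi_pos
  rcases hφ with ⟨h3, h4⟩ | ⟨h3, h4⟩
  · exact ⟨Real.sin_pos_of_pos_of_lt_pi h3 (by linarith), key _ (by linarith) (by linarith)⟩
  · refine ⟨Real.sin_pos_of_pos_of_lt_pi (by linarith) h4, ?_⟩
    -- The second interval is the reflection of the first under `φ ↦ π - φ`.
    rw [← Real.cos_two_pi_sub]
    exact key _ (by linarith) (by linarith)

theorem one_sub_cos_two_mul_pos {φ : ℝ} (hs : 0 < Real.sin φ) : 0 < 1 - Real.cos (2 * φ) := by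
  rw [Real.cos_two_mul, Real.cos_sq']
  have := pow_pos hs 2
  linarith

theorem disc_pos {n : ℕ} {lam φ : ℝ} (hlam : 0 < lam) (hφ : φ ∈ phiRange n lam) :
    0 < disc n lam φ := by
  obtain ⟨hs, hc⟩ := phiRange_facts hlam hφ
  have := one_sub_cos_two_mul_pos hs
  have := sub_pos.2 hc
  unfold disc
  positivity

theorem E₁_lt_E₂ {n : ℕ} {lam φ : ℝ} (hlam : 0 < lam) (hφ : φ ∈ phiRange n lam) :
    E₁ n lam φ < E₂ n lam φ := by
  have h := one_sub_cos_two_mul_pos (phiRange_facts hlam hφ).1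
  have := Real.sqrt_pos.2 (disc_pos hlam hφ)
  unfold E₁ E₂
  gcongr
  linarith

theorem quadT_eq {n : ℕ} {lam φ : ℝ} (hlam : 0 < lam) (hφ : φ ∈ phiRange n lam) (x : ℝ) :
    quadT n lam φ x = (1 - Real.cos (2 * φ)) * (x - E₁ n lam φ) * (x - E₂ n lam φ) := by
  have h := (one_sub_cos_two_mul_pos (phiRange_facts hlam hφ).1).ne'
  have hsq := Real.sq_sqrt (disc_pos hlam hφ).le
  have hD : (2 * lam + n + 1 : ℝ) ≠ 0 := by positivity
  have hd : disc n lam φ = (1 - Real.cos (2 * φ)) * ((n + 1 + 2 * lam) ^ 2 * Real.cos (2 * φ)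
      - (2 * lam - n - 1) * (2 * lam + n + 1)) := by
    unfold disc; field_simp; ring
  have hsc := Real.sin_sq_add_cos_sq (2 * φ)
  unfold quadT E₁ E₂
  generalize √(disc n lam φ) = r at *
  rw [hd] at hsq
  generalize Real.cos (2 * φ) = c at *
  generalize Real.sin (2 * φ) = s at *
  have hh : 2 * (1 - c) ≠ 0 := mul_ne_zero two_ne_zero h
  field_simp
  linear_combination hsq - (n + 1) ^ 2 * hsc

theorem sq_sub_pos {a b : ℝ} (h : a ≠ b) : 0 < (a - b) ^ 2 :=
  sq_pos_of_ne_zero (sub_ne_zero.2 h)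

theorem lin_mul_map (E : ℝ) (q : ℝ[X]) :
    lin E * q.map Complex.ofRealHom = ((X - C E) * q).map Complex.ofRealHom := by
  simp [lin]

/-! ### The configurations of the points `A`, `B` among the zeros `y` of `G` -/

section Gaps

variable {n : ℕ} {P G : ℝ[X]} {z : Fin n → ℝ} {y g : Fin (n + 1) → ℝ} {A B : ℝ}

/-- All factors `(y k - A) (y k - B)` would be negative. The sign changes then place all `n` zeros
of `P` below the last node, yet `P` is negative there and must vanish further right. -/
theorem not_lt_and_lt (hP : P.Monic) (hPd : P.natDegree = n) (hy : StrictMono y)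
    (hg : ∀ k, 0 < g k)
    (hv : ∀ k, P.eval (y k) = (-1) ^ (n - k.val) * ((y k - A) * (y k - B) * g k)) :
    ¬ (A < y 0 ∧ y (Fin.last n) < B) := by
  rintro ⟨hA, hB⟩
  have h1 : ∀ k, 0 < y k - A := fun k => sub_pos.2 (hA.trans_le (hy.monotone (Fin.zero_le k)))
  have h2 : ∀ k, y k - B < 0 := fun k =>
    sub_neg.2 ((hy.monotone (Fin.le_last k)).trans_lt hB)
  have hneg : ∀ k, (y k - A) * (y k - B) * g k < 0 := fun k =>
    mul_neg_of_neg_of_pos (mul_neg_of_pos_of_neg (h1 k) (h2 k)) (hg k)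
  have hgap := fun i => exists_root_gap hy hv i (mul_pos_of_neg_of_neg (hneg _) (hneg _))
  choose v v1 v2 v3 using hgap
  obtain ⟨-, hvm⟩ := strictMono_of_gaps fun k => ⟨v1 k, v2 k⟩
  have hlast := hv (Fin.last n)
  rw [Fin.val_last, Nat.sub_self, pow_zero, one_mul] at hlast
  obtain ⟨k, hk⟩ := exists_root_gt hP hPd hvm v3 (hlast.trans_lt (hneg _))
  exact (hk.trans (v2 k)).not_ge (hy.monotone (Fin.le_last _))

theorem interlace_of_pos (hP : P.Monic) (hPd : P.natDegree = n) (hG : G.Monic)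
    (hGd : G.natDegree = n + 1) (hy : StrictMono y) (hGy : ∀ k, G.eval (y k) = 0)
    (hg : ∀ k, 0 < g k)
    (hv : ∀ k, P.eval (y k) = (-1) ^ (n - k.val) * ((y k - A) * (y k - B) * g k))
    (hpos : ∀ k, 0 < (y k - A) * (y k - B)) :
    Interlace (G.map Complex.ofRealHom) (P.map Complex.ofRealHom) :=
  interlace_of_gaps hG hGd hP hPd hGy fun i => exists_root_gap hy hv i
    (mul_pos (mul_pos (hpos _) (hg _)) (mul_pos (hpos _) (hg _)))

theorem natDegree_X_sub_C_mul (hP : P.Monic) {m : ℕ} (hPd : P.natDegree = m) (E : ℝ) :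
    ((X - C E) * P).natDegree = m + 1 := by
  rw [(monic_X_sub_C E).natDegree_mul hP, natDegree_X_sub_C, hPd, add_comm]

/-- The factor `x - B` squares `y k - B`, so alternation holds in every gap. The one remaining zero
lies left of `y 0`, where `P(y 0)` has the sign opposite to that at `-∞`. -/
theorem alternate_of_lt_left (hP : P.Monic) (hPd : P.natDegree = n) (hG : G.Monic)
    (hGd : G.natDegree = n + 1) (hy : StrictMono y) (hGy : ∀ k, G.eval (y k) = 0)
    (hz : StrictMono z) (hPz : ∀ k, P.eval (z k) = 0) (hg : ∀ k, 0 < g k)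
    (hv : ∀ k, P.eval (y k) = (-1) ^ (n - k.val) * ((y k - A) * (y k - B) * g k))
    (hA : A < y 0) (hB : y 0 < B) (hBy : ∀ k, y k ≠ B) :
    Alternate (lin B * P.map Complex.ofRealHom) (G.map Complex.ofRealHom) := by
  have h1 : ∀ k, 0 < y k - A := fun k => sub_pos.2 (hA.trans_le (hy.monotone (Fin.zero_le k)))
  have hpos : ∀ k, 0 < (y k - A) * (y k - B) ^ 2 * g k := fun k => by
    have := hg k
    have := h1 k
    have := sub_ne_zero.2 (hBy k)
    positivity
  rw [lin_mul_map]
  refine alternate_of_left ((monic_X_sub_C B).mul hP) (natDegree_X_sub_C_mul hP hPd B) hG hGd hy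
    hGy fun k => ?_
  refine Fin.cases ?_ (fun i => ?_) k
  · have h0 : (-1) ^ n * P.eval (y 0) < 0 := by
      have e2 : ((-1 : ℝ) ^ n) * (-1) ^ n = 1 := by rw [← mul_pow]; simp
      rw [hv 0, Fin.val_zero, Nat.sub_zero, ← mul_assoc, e2, one_mul]
      exact mul_neg_of_neg_of_pos (mul_neg_of_pos_of_neg (h1 0) (sub_neg.2 hB)) (hg 0)
    obtain ⟨i, hi⟩ := exists_root_lt hP hPd hz hPz h0
    exact ⟨z i, by rw [eval_mul, hPz, mul_zero], hi, fun l hl => by simp at hl⟩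
  · obtain ⟨x, x1, x2, x3⟩ := exists_root_gap (q := (X - C B) * P) hy
      (s := fun k => (y k - A) * (y k - B) ^ 2 * g k)
      (fun k => by rw [eval_mul, hv]; simp only [eval_sub, eval_X, eval_C]; ring) i
      (mul_pos (hpos _) (hpos _))
    refine ⟨x, x3, x2, fun l hl => ?_⟩
    have : l = i.castSucc := Fin.ext (by simpa using hl.symm)
    rwa [this]

/-- Mirror image of `alternate_of_lt_left`: the extra zero of `P` lies right of the last node, where
`P` is negative. -/
theorem alternate_of_gt_right (hP : P.Monic) (hPd : P.natDegree = n) (hG : G.Monic)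
    (hGd : G.natDegree = n + 1) (hy : StrictMono y) (hGy : ∀ k, G.eval (y k) = 0)
    (hz : StrictMono z) (hPz : ∀ k, P.eval (z k) = 0) (hg : ∀ k, 0 < g k)
    (hv : ∀ k, P.eval (y k) = (-1) ^ (n - k.val) * ((y k - A) * (y k - B) * g k))
    (hB : y (Fin.last n) < B) (hA : A < y (Fin.last n)) (hAy : ∀ k, y k ≠ A) :
    Alternate (G.map Complex.ofRealHom) (lin A * P.map Complex.ofRealHom) := by
  have h1 : ∀ k, y k - B < 0 := fun k =>
    sub_neg.2 ((hy.monotone (Fin.le_last k)).trans_lt hB)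
  have hneg : ∀ k, (y k - A) ^ 2 * (y k - B) * g k < 0 := fun k =>
    mul_neg_of_neg_of_pos (mul_neg_of_pos_of_neg (sq_sub_pos (hAy k)) (h1 k)) (hg k)
  rw [lin_mul_map]
  refine alternate_of_right hG hGd ((monic_X_sub_C A).mul hP) (natDegree_X_sub_C_mul hP hPd A) hy
    hGy fun k => ?_
  refine Fin.lastCases ?_ (fun i => ?_) k
  · have h0 : P.eval (y (Fin.last n)) < 0 := by
      rw [hv, Fin.val_last, Nat.sub_self, pow_zero, one_mul]
      exact mul_neg_of_neg_of_pos (mul_neg_of_pos_of_neg (sub_pos.2 hA) (h1 _)) (hg _)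
    obtain ⟨i, hi⟩ := exists_root_gt hP hPd hz hPz h0
    exact ⟨z i, by rw [eval_mul, hPz, mul_zero], hi, fun l hl => absurd l.isLt (by simp [hl])⟩
  · obtain ⟨x, x1, x2, x3⟩ := exists_root_gap (q := (X - C A) * P) hy
      (s := fun k => (y k - A) ^ 2 * (y k - B) * g k)
      (fun k => by rw [eval_mul, hv]; simp only [eval_sub, eval_X, eval_C]; ring) i
      (mul_pos_of_neg_of_neg (hneg _) (hneg _))
    refine ⟨x, x3, x1, fun l hl => ?_⟩
    have : l = i.succ := Fin.ext (by simpa using hl)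
    rwa [this]

/-- After multiplication by `x - B`, alternation fails only in the gap containing `A`. There `A`
becomes a new node, and the given zeros `a`, `b` fill the two halves. -/
theorem interlace_of_three_in_gap (hP : P.Monic) (hPd : P.natDegree = n) (hG : G.Monic)
    (hGd : G.natDegree = n + 1) (hy : StrictMono y) (hGy : ∀ k, G.eval (y k) = 0)
    (hg : ∀ k, 0 < g k)
    (hv : ∀ k, P.eval (y k) = (-1) ^ (n - k.val) * ((y k - A) * (y k - B) * g k))
    (hBy : ∀ k, y k ≠ B) (k : Fin n) {a b : ℝ} (ha : P.eval a = 0) (hb : P.eval b = 0)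
    (hka : y k.castSucc < a) (haA : a < A) (hAb : A < b) (hbk : b < y k.succ) :
    Interlace (lin A * G.map Complex.ofRealHom) (lin B * P.map Complex.ofRealHom) := by
  have hgap : ∀ i : Fin n, i ≠ k →
      ∃ x, y i.castSucc < x ∧ x < y i.succ ∧ ((X - C B) * P).eval x = 0 := by
    intro i hi
    refine exists_root_gap hy (s := fun k => (y k - A) * (y k - B) ^ 2 * g k)
      (fun k => by rw [eval_mul, hv]; simp only [eval_sub, eval_X, eval_C]; ring) i ?_
    have hA : 0 < (y i.castSucc - A) * (y i.succ - A) := by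
      rcases lt_or_gt_of_ne hi with h | h
      · have h1 : y i.succ ≤ y k.castSucc := hy.monotone (Fin.succ_le_castSucc_iff.2 h)
        have h2 : y i.castSucc < y i.succ := hy Fin.castSucc_lt_succ
        exact mul_pos_of_neg_of_neg (by linarith) (by linarith)
      · have h1 : y k.succ ≤ y i.castSucc := hy.monotone (Fin.succ_le_castSucc_iff.2 h)
        have h2 : y i.castSucc < y i.succ := hy Fin.castSucc_lt_succ
        exact mul_pos (by linarith) (by linarith)
    have e1 := sq_sub_pos (hBy i.castSucc)
    have e2 := sq_sub_pos (hBy i.succ)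
    have := mul_pos hA (mul_pos (mul_pos e1 e2) (mul_pos (hg i.castSucc) (hg i.succ)))
    linarith
  rw [lin_mul_map, lin_mul_map]
  -- The nodes `y` with `A` inserted after index `k`; later indices shift by one.
  let w : Fin (n + 2) → ℝ := fun i =>
    if h : i.val ≤ k.val then y ⟨i.val, by omega⟩
    else if i.val = k.val + 1 then A else y ⟨i.val - 1, by omega⟩
  have w1 : ∀ i (h : i < n + 2) (h' : i ≤ k.val), w ⟨i, h⟩ = y ⟨i, by omega⟩ :=
    fun i h h' => dif_pos h'
  have w2 : ∀ (h : k.val + 1 < n + 2), w ⟨k.val + 1, h⟩ = A := fun h => by simp [w]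
  have w3 : ∀ i (h : i + 1 < n + 2), k.val < i → w ⟨i + 1, h⟩ = y ⟨i, by omega⟩ := by
    intro i h h'
    simp only [w]
    rw [dif_neg (by omega), if_neg (by omega)]
    rfl
  refine interlace_of_gaps (w := w) ((monic_X_sub_C A).mul hG) (natDegree_X_sub_C_mul hG hGd A)
    ((monic_X_sub_C B).mul hP) (natDegree_X_sub_C_mul hP hPd B) ?_ ?_
  · rintro ⟨i, hi⟩
    rw [eval_mul]
    rcases lt_trichotomy i (k.val + 1) with h | h | h
    · rw [w1 i hi (by omega), hGy, mul_zero]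
    · subst h
      rw [w2]; simp
    · obtain ⟨j, rfl⟩ : ∃ j, i = j + 1 := ⟨i - 1, by omega⟩
      rw [w3 j hi (by omega), hGy, mul_zero]
  · rintro ⟨i, hi⟩
    change ∃ x, w ⟨i, _⟩ < x ∧ x < w ⟨i + 1, _⟩ ∧ _
    rcases lt_trichotomy i k.val with h | h | h
    · rw [w1 i _ h.le, w1 (i + 1) _ h]
      exact hgap ⟨i, by omega⟩ (Fin.ne_of_val_ne h.ne)
    · subst h
      rw [w1 _ _ le_rfl, w2]
      exact ⟨a, hka, haA, by rw [eval_mul, ha, mul_zero]⟩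
    · rw [w3 i _ h]
      rcases eq_or_lt_of_le (Nat.succ_le_of_lt h) with h | h
      · change k.val + 1 = i at h
        subst h
        rw [w2]
        exact ⟨b, hAb, hbk, by rw [eval_mul, hb, mul_zero]⟩
      · obtain ⟨j, rfl⟩ : ∃ j, i = j + 1 := ⟨i - 1, by omega⟩
        have hj : k.val < j := by omega
        rw [w3 j _ hj]
        exact hgap ⟨j, by omega⟩ (Fin.ne_of_val_ne hj.ne')

end Gaps

end MP

/-! ### Assembly -/

theorem corollary3p2 (n : ℕ) (hn : 1 ≤ n) (lam : ℝ) (hlam : 0 < lam)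
    (φ : ℝ) (hφ : φ ∈ MP.phiRange n lam)
    (hcommon : ∀ w : ℂ, ¬ ((MP.meixnerPollaczek n lam φ).IsRoot w ∧
      (MP.meixnerPollaczek (n + 1) (lam + 1) φ).IsRoot w)) :
    -- `E₁ < E₂` are the zeros of the quadratic
    (MP.E₁ n lam φ < MP.E₂ n lam φ ∧
      ∀ x : ℝ, MP.quadT n lam φ x = 0 ↔ x = MP.E₁ n lam φ ∨ x = MP.E₂ n lam φ) ∧
    -- both polynomials have only real and simple zeros
    (∃ z : Fin n → ℝ, MP.IsZeros (MP.meixnerPollaczek n lam φ) z) ∧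
    (∃ y : Fin (n + 1) → ℝ, MP.IsZeros (MP.meixnerPollaczek (n + 1) (lam + 1) φ) y) ∧
    ∀ (z : Fin n → ℝ) (y : Fin (n + 1) → ℝ),
      MP.IsZeros (MP.meixnerPollaczek n lam φ) z →
      MP.IsZeros (MP.meixnerPollaczek (n + 1) (lam + 1) φ) y →
      -- the impossible configuration
      ¬ (MP.E₁ n lam φ < y 0 ∧ y (Fin.last n) < MP.E₂ n lam φ) ∧
      -- both points in the same interval
      ((MP.E₁ n lam φ < y 0 ∧ MP.E₂ n lam φ < y 0) ∨
        (∃ k : Fin n, (y k.castSucc < MP.E₁ n lam φ ∧ MP.E₁ n lam φ < y k.succ) ∧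
          (y k.castSucc < MP.E₂ n lam φ ∧ MP.E₂ n lam φ < y k.succ)) ∨
        (y (Fin.last n) < MP.E₁ n lam φ ∧ y (Fin.last n) < MP.E₂ n lam φ) →
          MP.Interlace (MP.meixnerPollaczek (n + 1) (lam + 1) φ) (MP.meixnerPollaczek n lam φ)) ∧
      -- one point to the left of all zeros, the other in a gap
      (MP.E₁ n lam φ < y 0 →
        (∃ k : Fin n, y k.castSucc < MP.E₂ n lam φ ∧ MP.E₂ n lam φ < y k.succ) →
          MP.Alternate (MP.lin (MP.E₂ n lam φ) * MP.meixnerPollaczek n lam φ)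
            (MP.meixnerPollaczek (n + 1) (lam + 1) φ)) ∧
      -- one point to the right of all zeros, the other in a gap
      (y (Fin.last n) < MP.E₂ n lam φ →
        (∃ k : Fin n, y k.castSucc < MP.E₁ n lam φ ∧ MP.E₁ n lam φ < y k.succ) →
          MP.Alternate (MP.meixnerPollaczek (n + 1) (lam + 1) φ)
            (MP.lin (MP.E₁ n lam φ) * MP.meixnerPollaczek n lam φ)) ∧
      -- the two points in different gaps
      (∀ k k' : Fin n, k ≠ k' →
        (y k.castSucc < MP.E₁ n lam φ ∧ MP.E₁ n lam φ < y k.succ) →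
        (y k'.castSucc < MP.E₂ n lam φ ∧ MP.E₂ n lam φ < y k'.succ) →
        ∀ l l' : Fin n, l'.val = l.val + 1 →
          ((y k.castSucc < z l ∧ z l < MP.E₁ n lam φ ∧ MP.E₁ n lam φ < z l' ∧ z l' < y k.succ) →
            MP.Interlace (MP.lin (MP.E₁ n lam φ) * MP.meixnerPollaczek (n + 1) (lam + 1) φ)
              (MP.lin (MP.E₂ n lam φ) * MP.meixnerPollaczek n lam φ)) ∧
          ((y k'.castSucc < z l ∧ z l < MP.E₂ n lam φ ∧ MP.E₂ n lam φ < z l' ∧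
              z l' < y k'.succ) →
            MP.Interlace (MP.lin (MP.E₂ n lam φ) * MP.meixnerPollaczek (n + 1) (lam + 1) φ)
              (MP.lin (MP.E₁ n lam φ) * MP.meixnerPollaczek n lam φ))) := by
  obtain ⟨hs, -⟩ := MP.phiRange_facts hlam hφ
  have hs' := hs.ne'
  have hlam' : 0 < lam + 1 := by linarith
  have hc := MP.one_sub_cos_two_mul_pos hs
  have hE := MP.E₁_lt_E₂ hlam hφ
  have hT := MP.quadT_eq hlam hφ
  rw [MP.map_mp hs' hlam, MP.map_mp hs' hlam']
  obtain ⟨hP, hPd⟩ := MP.mp_monic lam φ n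
  obtain ⟨hG, hGd⟩ := MP.mp_monic (lam + 1) φ (n + 1)
  refine ⟨⟨hE, fun x => ?_⟩, MP.exists_isZeros_mp hlam hs' n,
    MP.exists_isZeros_mp hlam' hs' (n + 1), fun z y hz hy => ?_⟩
  · rw [hT, mul_eq_zero, mul_eq_zero, or_iff_right hc.ne', sub_eq_zero, sub_eq_zero]
  have hPz := hz.eval_eq_zero
  have hGy := hy.eval_eq_zero
  have hzm := hz.2.1
  have hym := hy.2.1
  have hsign := MP.mp_eval_root_sign hlam' hs' hym hGy
  set A := MP.E₁ n lam φ
  set B := MP.E₂ n lam φ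
  set P := MP.mp lam φ n
  set G := MP.mp (lam + 1) φ (n + 1)
  have hD : 0 < (n + 2 * lam) * (n + 1 + 2 * lam) := by positivity
  -- All the positive factors of `P(y k)`: the constants of `mp_eval_of_root`, the leading
  -- coefficient of `quadT`, and the preceding polynomial with its alternating sign removed.
  let g : Fin (n + 1) → ℝ := fun k => 2 * (1 - Real.cos (2 * φ))
    / ((n + 2 * lam) * (n + 1 + 2 * lam))
    * ((-1) ^ (n - k.val) * (MP.mp (lam + 1) φ n).eval (y k))
  have hg : ∀ k, 0 < g k := fun k => mul_pos (by positivity) (hsign k)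
  have hv : ∀ k, P.eval (y k) = (-1) ^ (n - k.val) * ((y k - A) * (y k - B) * g k) := by
    intro k
    have h := MP.mp_eval_of_root hs' hn (hGy k)
    rw [hT] at h
    have e2 : ((-1 : ℝ) ^ (n - k.val)) * (-1) ^ (n - k.val) = 1 := by rw [← mul_pow]; simp
    refine mul_left_cancel₀ hD.ne' (h.trans ?_)
    simp only [g]
    have hr := mul_div_cancel₀ (2 * (1 - Real.cos (2 * φ))) hD.ne'
    generalize 2 * (1 - Real.cos (2 * φ)) / ((n + 2 * lam) * (n + 1 + 2 * lam)) = r at *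
    generalize (-1 : ℝ) ^ (n - k.val) = σ at *
    linear_combination (-(y k - A) * (y k - B) * (MP.mp (lam + 1) φ n).eval (y k)) *
      (2 * (1 - Real.cos (2 * φ)) * e2 + σ ^ 2 * hr)
  have hne : ∀ (k : Fin n) (E : ℝ), y k.castSucc < E → E < y k.succ → ∀ j, y j ≠ E := by
    rintro k E h1 h2 j rfl
    exact absurd (hym.lt_iff_lt.1 h2) (not_lt.2 (Fin.castSucc_lt_iff_succ_le.1 (hym.lt_iff_lt.1 h1)))
  refine ⟨MP.not_lt_and_lt hP hPd hym hg hv, fun h => ?_, ?_, ?_, ?_⟩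
  · refine MP.interlace_of_pos hP hPd hG hGd hym hGy hg hv fun j => ?_
    rcases h with ⟨h1, h2⟩ | ⟨k, ⟨h1, h2⟩, h3, h4⟩ | ⟨h1, h2⟩
    · have := hym.monotone (Fin.zero_le j)
      exact mul_pos (by linarith) (by linarith)
    · rcases le_or_gt j k.castSucc with hj | hj
      · have := hym.monotone hj
        exact mul_pos_of_neg_of_neg (by linarith) (by linarith)
      · have := hym.monotone (Fin.castSucc_lt_iff_succ_le.1 hj)
        exact mul_pos (by linarith) (by linarith)
    · have := hym.monotone (Fin.le_last j)
      exact mul_pos_of_neg_of_neg (by linarith) (by linarith)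
  · rintro hA ⟨k, h1, h2⟩
    exact MP.alternate_of_lt_left hP hPd hG hGd hym hGy hzm hPz hg hv hA
      ((hym.monotone (Fin.zero_le _)).trans_lt h1) (hne k B h1 h2)
  · rintro hB ⟨k, h1, h2⟩
    exact MP.alternate_of_gt_right hP hPd hG hGd hym hGy hzm hPz hg hv hB
      (h2.trans_le (hym.monotone (Fin.le_last _))) (hne k A h1 h2)
  · rintro k k' - ⟨hA1, hA2⟩ ⟨hB1, hB2⟩ l l' -
    refine ⟨fun ⟨h1, h2, h3, h4⟩ => ?_, fun ⟨h1, h2, h3, h4⟩ => ?_⟩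
    · exact MP.interlace_of_three_in_gap hP hPd hG hGd hym hGy hg hv (hne k' B hB1 hB2) k
        (hPz l) (hPz l') h1 h2 h3 h4
    -- The hypothesis on values is symmetric in `A` and `B`, so the same lemma applies with them
    -- exchanged.
    · exact MP.interlace_of_three_in_gap hP hPd hG hGd hym hGy hg
        (fun j => (hv j).trans (by ring)) (hne k A hA1 hA2) k' (hPz l) (hPz l') h1 h2 h3 h4
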